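/- For all real numbers $c$ and $K_0>1$ there is a constant $C=C(c,K_0)>0$ such that the following holds for all integers $n,k,m\ge 0$ and all real $K\ge K_0$. Let $\|\cdot\|$ be a norm on $\mathbb{R}^n$ with $n^{-c}\le \|x\|/\|x\|_2\le n^{c}$ for all $x\neq 0$. Suppose there is a randomized linear $k$-sparse recovery scheme with $m$ measurements and approximation factor $K$ over nonnegative inputs, i.e. a joint distribution of a random matrix $A\in\mathbb{R}^{m\times n}$ and a random recovery algorithm $\mathcal{A}\colon\mathbb{R}^m\to\mathbb{R}^n$ ($A$ being a measurable function of the random seed, and $\mathcal{A}$ being jointly measurable in the seed and its argument) such that for every $x\in[0,\infty)^n$, with probability at least $3/4$, $$\|x-\mathcal{A}(Ax)\|\le K\cdot\min_{x'\ k\text{-sparse}}\|x-x'\| .$$ Then $$m\ \ge\ C\cdot\frac{d}{\log K},$$ where $d$ is the doubling dimension of the set of nonnegative $k$-sparse vectors of $\mathbb{R}^n$ with the metric $\|x-y\|$. Here a vector is $k$-sparse if at most $k$ of its coordinates are nonzero, and the doubling dimension of a metric space is $\log_2\lambda$, where $\lambda$ is the least number such that every (closed) ball of the space can be covered by $\lambda$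 balls of the space of half its radius. -/

import Mathlib

open MeasureTheory
open scoped Matrix

/-- A vector is `k`-sparse if it has at most `k` nonzero coordinates. -/
def IsSparse {n : ℕ} (k : ℕ) (x : Fin n → ℝ) : Prop :=
  (Function.support x).ncard ≤ k

/-- The set of `k`-sparse vectors of `ℝⁿ` all of whose coordinates are nonnegative. -/
def nonnegSparse (n k : ℕ) : Set (Fin n → ℝ) :=
  {x | (∀ i, 0 ≤ x i) ∧ IsSparse k x}

/-- The error `min_{x' k-sparse} N (x - x')` of the best `k`-sparse approximation of `x`
(the infimum is over a nonempty family of nonnegative reals). -/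
noncomputable def sparseError {n : ℕ} (N : Seminorm ℝ (Fin n → ℝ)) (k : ℕ)
    (x : Fin n → ℝ) : ℝ :=
  ⨅ x' : {x' : Fin n → ℝ // IsSparse k x'}, N (x - x')

/-- `N` is polynomially related to the Euclidean norm with exponent `c`:
`n^{-c} ≤ N x / ‖x‖₂ ≤ n^c` for all `x ≠ 0`. In particular `N` is a norm. -/
def PolyBounded {n : ℕ} (c : ℝ) (N : Seminorm ℝ (Fin n → ℝ)) : Prop :=
  ∀ x : Fin n → ℝ,
    (n : ℝ) ^ (-c) * ‖WithLp.toLp 2 x‖ ≤ N x ∧ N x ≤ (n : ℝ) ^ c * ‖WithLp.toLp 2 x‖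

/-- In the space `S` with the metric `N (x - y)`, every ball is covered by at most `M` balls
of half its radius. All balls are closed balls of `S`, with centres in `S`. -/
def IsDoublingBound {n : ℕ} (N : Seminorm ℝ (Fin n → ℝ)) (S : Set (Fin n → ℝ)) (M : ℕ) :
    Prop :=
  ∀ p ∈ S, ∀ r : ℝ, 0 < r → ∃ t : Finset (Fin n → ℝ), (∀ y ∈ t, y ∈ S) ∧ t.card ≤ M ∧
    ∀ x ∈ S, N (x - p) ≤ r → ∃ y ∈ t, N (x - y) ≤ r / 2

/-- The doubling constant: the least number of balls of half the radius that suffices to cover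
any ball. -/
noncomputable def doublingConstant {n : ℕ} (N : Seminorm ℝ (Fin n → ℝ))
    (S : Set (Fin n → ℝ)) : ℕ :=
  sInf {M : ℕ | IsDoublingBound N S M}

/-- The doubling dimension: the binary logarithm of the doubling constant. -/
noncomputable def doublingDim {n : ℕ} (N : Seminorm ℝ (Fin n → ℝ))
    (S : Set (Fin n → ℝ)) : ℝ :=
  Real.logb 2 (doublingConstant N S)

/-- The infimum in the definition of the doubling constant is attained. -/
theorem isDoublingBound_doublingConstant {n : ℕ} {c : ℝ} {N : Seminorm ℝ (Fin n → ℝ)}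
    (hN : PolyBounded c N) (S : Set (Fin n → ℝ)) :
    IsDoublingBound N S (doublingConstant N S) := by
  classical
  suffices h : {M : ℕ | IsDoublingBound N S M}.Nonempty from Nat.sInf_mem h
  rcases Nat.eq_zero_or_pos n with rfl | hn
  · refine ⟨1, fun p hp r hr => ⟨{p}, by simpa using hp, by simp, fun x _ _ => ⟨p, by simp, ?_⟩⟩⟩
    rw [Subsingleton.elim x p, sub_self, map_zero]
    positivity
  have ha : (0 : ℝ) < (n : ℝ) ^ c := Real.rpow_pos_of_pos (by exact_mod_cast hn) c
  have hK : IsCompact (Metric.closedBall (0 : EuclideanSpace ℝ (Fin n)) ((n : ℝ) ^ c)) :=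
    isCompact_closedBall _ _
  have hδ : (0 : ℝ) < ((n : ℝ) ^ c)⁻¹ / 4 := by positivity
  obtain ⟨T, -, hTfin, hT⟩ := Metric.totallyBounded_iff.1 hK.totallyBounded _ hδ |>.imp
    fun T h => (⟨trivial, h.1, h.2⟩ : True ∧ _ ∧ _)
  refine ⟨hTfin.toFinset.card, fun p hp r hr => ?_⟩
  -- `cell z x`: the rescaled point `x` lies in the piece around `z`
  let cell : EuclideanSpace ℝ (Fin n) → (Fin n → ℝ) → Prop := fun z x =>
    x ∈ S ∧ N (x - p) ≤ r ∧ dist (WithLp.toLp 2 (r⁻¹ • (x - p))) z < ((n : ℝ) ^ c)⁻¹ / 4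
  let f : EuclideanSpace ℝ (Fin n) → (Fin n → ℝ) := fun z =>
    if h : ∃ x, cell z x then h.choose else p
  refine ⟨hTfin.toFinset.image f, ?_, Finset.card_image_le, fun x hx hxr => ?_⟩
  · intro y hy
    obtain ⟨z, -, rfl⟩ := Finset.mem_image.1 hy
    by_cases h : ∃ x, cell z x
    · simp only [f, dif_pos h]; exact h.choose_spec.1
    · simpa only [f, dif_neg h] using hp
  · have hmem : WithLp.toLp 2 (r⁻¹ • (x - p)) ∈
        Metric.closedBall (0 : EuclideanSpace ℝ (Fin n)) ((n : ℝ) ^ c) := by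
      rw [mem_closedBall_zero_iff]
      have h1 := (hN (r⁻¹ • (x - p))).1
      rw [map_smul_eq_mul, Real.rpow_neg (by positivity), Real.norm_of_nonneg (by positivity)] at h1
      have h2 : r⁻¹ * N (x - p) ≤ 1 := by
        rw [inv_mul_le_iff₀ hr]; simpa using hxr
      have h3 := h1.trans h2
      rw [inv_mul_le_iff₀ ha] at h3
      simpa using h3
    obtain ⟨z, hz, hxz⟩ := Set.mem_iUnion₂.1 (hT hmem)
    have hc : ∃ x, cell z x := ⟨x, hx, hxr, hxz⟩
    refine ⟨f z, Finset.mem_image_of_mem _ (hTfin.mem_toFinset.2 hz), ?_⟩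
    have hf : cell z (f z) := by simp only [f, dif_pos hc]; exact hc.choose_spec
    have hd : dist (WithLp.toLp 2 (r⁻¹ • (x - p)) : EuclideanSpace ℝ (Fin n))
        (WithLp.toLp 2 (r⁻¹ • (f z - p))) ≤ ((n : ℝ) ^ c)⁻¹ / 2 := by
      have := dist_triangle_right (WithLp.toLp 2 (r⁻¹ • (x - p)) : EuclideanSpace ℝ (Fin n))
        (WithLp.toLp 2 (r⁻¹ • (f z - p))) z
      have h1 := hf.2.2
      have h2 : dist (WithLp.toLp 2 (r⁻¹ • (x - p))) z < ((n : ℝ) ^ c)⁻¹ / 4 := hxz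
      linarith
    rw [dist_eq_norm, ← WithLp.toLp_sub, ← smul_sub, sub_sub_sub_cancel_right] at hd
    have h1 := (hN (r⁻¹ • (x - f z))).2
    rw [map_smul_eq_mul, Real.norm_of_nonneg (by positivity)] at h1
    have h2 := h1.trans (mul_le_mul_of_nonneg_left hd ha.le)
    have h3 : (n : ℝ) ^ c * (((n : ℝ) ^ c)⁻¹ / 2) = 1 / 2 := by field_simp
    rw [h3, inv_mul_le_iff₀ hr] at h2
    linarith

/-- A randomized linear sketch with `m` measurements of vectors of `ℝⁿ`: a random `m × n` matrix
and a random recovery algorithm, both functions of the random seed `ω`, chosen before the input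
is seen. Recovery is an arbitrary (jointly measurable) function of the seed and the `m` linear
measurements. -/
structure LinearScheme (Ω : Type*) [MeasurableSpace Ω] (m n : ℕ) where
  /-- the random measurement matrix -/
  mat : Ω → Matrix (Fin m) (Fin n) ℝ
  /-- the random recovery algorithm -/
  recover : Ω → (Fin m → ℝ) → (Fin n → ℝ)
  measurable_mat : ∀ i j, Measurable fun ω => mat ω i j
  measurable_recover : Measurable fun q : Ω × (Fin m → ℝ) => recover q.1 q.2

/-- The sparse recovery guarantee over nonnegative inputs, with approximation factor `K` and
failure probability at most `1/4`: for each `x ∈ [0, ∞)ⁿ`, with probability at least `3/4` the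
vector `y` recovered from the measurements of `x` satisfies
`N (x - y) ≤ K * min_{x' k-sparse} N (x - x')`. -/
def LinearScheme.RecoversNonneg {Ω : Type*} [MeasurableSpace Ω] {m n : ℕ}
    (A : LinearScheme Ω m n) (P : Measure Ω) (N : Seminorm ℝ (Fin n → ℝ)) (k : ℕ) (K : ℝ) :
    Prop :=
  ∀ x : Fin n → ℝ, (∀ i, 0 ≤ x i) →
    3 / 4 ≤ P.real {ω | N (x - A.recover ω (A.mat ω *ᵥ x)) ≤ K * sparseError N k x}

/-! Let λ be the doubling constant. A ball not covered by λ - 1 balls of half its radius r contains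
λ points with pairwise distances in (r/2, 2r]. A message superposes 2q of them with weights s^j,
where s = 1/(32(K+1)). Divided by its leading weight, the tail of a message from layer i on is close
to a multiple of the point in layer i: the points may be large, but their differences are not. The
multiple is k-sparse, so recovery of the tail identifies the point. By linearity the layers already
known can be subtracted from the measurements, so the layers are decoded one after another
(`eq_of_mulVec_layered_eq`).

Real measurements carry unboundedly many bits, so noise from a small box is added and volumes are
compared. For a fixed seed, each message has the same measurements as a vector supported on at most
m common columns (`exists_columns_supporting_image`). The sets of noise for which decoding works,
translated by these vectors, are disjoint and lie in the box enlarged in at most m directions, which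
costs a factor (const · (32(K+1))^{2q})^m.

A layer may fail with probability 1/4, so a union bound over layers is not available. Instead a seed
is fixed for which 3/4 of the layers decode on average. Often at least q of the 2q layers then
decode, and the others are given away at the cost of a factor 4^q λ^q (`card_pow_mul_measure_le`).
Hence λ^q ≤ C (4 (32(K+1))^{2m})^q with C independent of q, and letting q grow removes C together
with the sizes of the points and of the noise. -/

/-! ### Bounded coordinates, separated points, disjoint translates -/

/-- A finite spanning family of a finite-dimensional space contains a basis in which every member
of the family has coordinates of absolute value at most one. -/
theorem exists_basis_coord_le_one {ι W : Type*} [Finite ι] [AddCommGroup W] [Module ℝ W]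
    [FiniteDimensional ℝ W] (a : ι → W) (ha : Submodule.span ℝ (Set.range a) = ⊤) :
    ∃ (e : Fin (Module.finrank ℝ W) → ι) (B : ι → Fin (Module.finrank ℝ W) → ℝ),
      (∀ j i, |B j i| ≤ 1) ∧ ∀ j, a j = ∑ i, B j i • a (e i) := by
  classical
  let b := Module.finBasis ℝ W
  obtain ⟨f, hf, -, hfi⟩ := Submodule.exists_fun_fin_finrank_span_eq ℝ (Set.range a)
  have hcard : Module.finrank ℝ W = Module.finrank ℝ (Submodule.span ℝ (Set.range a)) := by
    rw [ha, finrank_top]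
  choose e₀ he₀ using fun i => hf (finCongr hcard i)
  have hli₀ : LinearIndependent ℝ (a ∘ e₀) := by
    have h : a ∘ e₀ = f ∘ finCongr hcard := funext he₀
    rw [h]
    exact hfi.comp _ (finCongr hcard).injective
  have hspan : ∀ e : Fin (Module.finrank ℝ W) → ι, LinearIndependent ℝ (a ∘ e) →
      ⊤ ≤ Submodule.span ℝ (Set.range (a ∘ e)) := fun e he =>
    (he.span_eq_top_of_card_eq_finrank' (by simp)).ge
  have : Nonempty (Fin (Module.finrank ℝ W) → ι) := ⟨e₀⟩
  -- The subfamily of largest determinant works: by Cramer's rule each coordinate is the ratio of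
  -- another such determinant to the maximal one.
  obtain ⟨e, he⟩ := Finite.exists_max fun e : Fin (Module.finrank ℝ W) → ι => |b.det (a ∘ e)|
  have hdet₀ : b.det (a ∘ e₀) ≠ 0 :=
    ((Module.Basis.is_basis_iff_det b).1 ⟨hli₀, top_le_iff.1 (hspan _ hli₀)⟩).ne_zero
  have hdet : 0 < |b.det (a ∘ e)| := (abs_pos.2 hdet₀).trans_le (he e₀)
  have hli : LinearIndependent ℝ (a ∘ e) :=
    ((Module.Basis.is_basis_iff_det b).2 (abs_pos.1 hdet).isUnit).1
  let b' := Module.Basis.mk hli (hspan e hli)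
  refine ⟨e, fun j i => b'.repr (a j) i, fun j i => ?_, fun j => ?_⟩
  · have h := LinearMap.congr_fun (b.det_smul_mk_coord_eq_det_update hli (hspan e hli) i) (a j)
    have h1 : b.det (a ∘ e) * b'.repr (a j) i = b.det (a ∘ Function.update e i j) := by
      rw [Function.comp_update]
      exact h
    have h2 := he (Function.update e i j)
    simp only [← h1, abs_mul] at h2
    exact le_of_mul_le_mul_left (by simpa using h2) hdet
  · conv_lhs => rw [← b'.sum_repr (a j)]
    simp [b']

/-- Every ball that cannot be covered by fewer than `doublingConstant N S` balls of half its radius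
contains a separated set of that cardinality. -/
theorem exists_separated_of_lt_doublingConstant {n : ℕ} (N : Seminorm ℝ (Fin n → ℝ))
    (S : Set (Fin n → ℝ)) {l : ℕ} (hl : l < doublingConstant N S) :
    ∃ (p : Fin n → ℝ) (r : ℝ), 0 < r ∧ ∃ y : Fin (l + 1) → Fin n → ℝ,
      (∀ i, y i ∈ S ∧ N (y i - p) ≤ r) ∧ ∀ i j, i ≠ j → r / 2 < N (y i - y j) := by
  classical
  have h := Nat.notMem_of_lt_sInf hl
  simp only [Set.mem_ofPred_eq, IsDoublingBound, not_forall] at h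
  obtain ⟨p, hp, r, hr, h⟩ := h
  refine ⟨p, r, hr, ?_⟩
  -- Greedy choice: the at most `l` points chosen so far cannot be the centres of a cover by balls
  -- of radius `r / 2`.
  have key : ∀ j ≤ l + 1, ∃ y : Fin j → Fin n → ℝ,
      (∀ i, y i ∈ S ∧ N (y i - p) ≤ r) ∧ ∀ i j, i ≠ j → r / 2 < N (y i - y j) := by
    intro j
    induction j with
    | zero => exact fun _ => ⟨Fin.elim0, fun i => i.elim0, fun i => i.elim0⟩
    | succ j ih =>
      intro hj
      obtain ⟨y, hy, hsep⟩ := ih (by omega)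
      have : ∃ x ∈ S, N (x - p) ≤ r ∧ ∀ i, r / 2 < N (x - y i) := by
        by_contra! hcon
        refine h ⟨Finset.univ.image y, ?_, ?_, fun x hx hxr => ?_⟩
        · intro z hz
          obtain ⟨i, -, rfl⟩ := Finset.mem_image.1 hz
          exact (hy i).1
        · exact Finset.card_image_le.trans (by simp; omega)
        · obtain ⟨i, hi⟩ := hcon x hx hxr
          exact ⟨y i, Finset.mem_image_of_mem _ (Finset.mem_univ _), hi⟩
      obtain ⟨x, hxS, hxr, hx⟩ := this
      refine ⟨Fin.cons x y, fun i => ?_, fun i i' hne => ?_⟩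
      · refine Fin.cases ⟨hxS, hxr⟩ (fun i => ?_) i
        simpa using hy i
      · revert hne
        refine Fin.cases (Fin.cases ?_ (fun i' => ?_) i') (fun i => Fin.cases ?_ (fun i' => ?_) i') i
        · simp
        · intro _; simpa using hx i'
        · intro _
          have := hx i
          rw [map_sub_rev] at this
          simpa using this
        · intro hne
          simpa using hsep i i' (fun h => hne (by rw [h]))
  exact key _ le_rfl

/-- Subsets of a measurable set that become disjoint after translation, without leaving `T`,
have total measure at most that of `T`. -/
theorem sum_measure_le_of_disjoint_translates {G ι : Type*} [AddGroup G] [MeasurableSpace G]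
    [MeasurableAdd G] (μ : Measure G) [μ.IsAddRightInvariant] (I : Finset ι)
    (E : ι → Set G) (hE : ∀ i ∈ I, MeasurableSet (E i)) (v : ι → G) (T : Set G)
    (hT : ∀ i ∈ I, ∀ u ∈ E i, u + v i ∈ T)
    (hd : ∀ i ∈ I, ∀ j ∈ I, ∀ u ∈ E i, ∀ u' ∈ E j, u + v i = u' + v j → i = j) :
    ∑ i ∈ I, μ (E i) ≤ μ T := by
  have h1 : ∑ i ∈ I, μ (E i) = ∑ i ∈ I, μ ((fun w => w + -v i) ⁻¹' E i) :=
    Finset.sum_congr rfl fun i _ => (measure_preimage_add_right μ (-v i) (E i)).symm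
  rw [h1, ← measure_biUnion_finset]
  · refine measure_mono (Set.iUnion₂_subset fun i hi w hw => ?_)
    simpa using hT i hi _ hw
  · intro i hi j hj hne
    refine Set.disjoint_left.2 fun w hw hw' => hne ?_
    exact hd i hi j hj _ hw _ hw' (by simp)
  · exact fun i hi => measurable_add_const _ (hE i hi)

/-- Every matrix has a small set `S` of columns such that any vector can be replaced by a vector
supported in `S` with the same image and entries that are not much larger. -/
theorem exists_columns_supporting_image {m n : ℕ} (A : Matrix (Fin m) (Fin n) ℝ) :
    ∃ S : Finset (Fin n), S.card ≤ m ∧ ∀ (ρ : ℝ) (x : Fin n → ℝ), (∀ i, |x i| ≤ ρ) →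
      ∃ v : Fin n → ℝ, (∀ i ∉ S, v i = 0) ∧ (∀ i, |v i| ≤ m * (n * ρ)) ∧ A *ᵥ v = A *ᵥ x := by
  classical
  let V := Submodule.span ℝ (Set.range fun j => A.col j)
  let a : Fin n → V := fun j => ⟨A.col j, Submodule.subset_span ⟨j, rfl⟩⟩
  have ha : Submodule.span ℝ (Set.range a) = ⊤ := by
    have := Submodule.span_span_coe_preimage (R := ℝ) (s := Set.range fun j => A.col j)
    convert this using 2
    ext ⟨z, hz⟩
    simp [a]
  obtain ⟨e, B, hB, hrep⟩ := exists_basis_coord_le_one a ha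
  have hr : Module.finrank ℝ V ≤ m := by
    simpa using Submodule.finrank_le V
  refine ⟨Finset.univ.image e, Finset.card_image_le.trans (by simpa using hr), fun ρ x hx => ?_⟩
  let w : Fin (Module.finrank ℝ V) → ℝ := fun i => ∑ j, x j * B j i
  have hw : ∀ i, |w i| ≤ n * ρ := fun i => by
    refine (Finset.abs_sum_le_sum_abs _ _).trans ?_
    refine (Finset.sum_le_sum (g := fun _ => ρ) fun j _ => ?_).trans (by simp)
    rw [abs_mul]
    exact (mul_le_of_le_one_right (abs_nonneg _) (hB j i)).trans (hx j)
  -- Injectivity of `e` is not at hand, so up to `m` coefficients may fall on one coordinate; hence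
  -- the factor `m` in the bound.
  refine ⟨∑ i, w i • Pi.single (e i) 1, fun j hj => ?_, fun j => ?_, ?_⟩
  · rw [Finset.sum_apply]
    refine Finset.sum_eq_zero fun i _ => ?_
    have : j ≠ e i := fun h => hj (Finset.mem_image.2 ⟨i, Finset.mem_univ _, h.symm⟩)
    simp [this]
  · rw [Finset.sum_apply]
    have h0 : 0 ≤ n * ρ := by
      have : 0 ≤ ρ := (abs_nonneg _).trans (hx j)
      positivity
    refine (Finset.abs_sum_le_sum_abs _ _).trans ?_
    refine (Finset.sum_le_sum (g := fun _ => n * ρ) fun i _ => ?_).trans ?_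
    · by_cases h : j = e i
      · subst h; simpa using hw i
      · simpa [h] using h0
    · simp only [Finset.sum_const, Finset.card_univ, Fintype.card_fin, nsmul_eq_mul]
      gcongr
  · rw [Matrix.mulVec_sum]
    have hcol : ∀ j, A.col j = ∑ i, B j i • A.col (e i) := fun j => by
      have := congrArg Subtype.val (hrep j)
      simpa [a] using this
    have hx' : A *ᵥ x = ∑ j, x j • A.col j := by
      ext i; simp [Matrix.mulVec, dotProduct, mul_comm, Matrix.col]
    rw [hx']
    simp_rw [Matrix.mulVec_smul, Matrix.mulVec_single_one]
    calc ∑ i, w i • A.col (e i) = ∑ i, ∑ j, (x j * B j i) • A.col (e i) := by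
          simp_rw [w, Finset.sum_smul]
      _ = ∑ j, ∑ i, (x j * B j i) • A.col (e i) := Finset.sum_comm
      _ = ∑ j, x j • A.col j := Finset.sum_congr rfl fun j _ => by
          conv_rhs => rw [hcol j]
          simp_rw [mul_smul, Finset.smul_sum]

/-! ### Superposition of layers and successive decoding -/

/-- The layers `z i, z (i + 1), …` superposed with geometrically decaying weights, the first of
them with weight one. -/
def layeredTail {R n : ℕ} (s : ℝ) (z : Fin R → Fin n → ℝ) (i : Fin R) : Fin n → ℝ :=
  ∑ j ∈ Finset.Ici i, s ^ (j - i : ℕ) • z j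

/-- The total weight of the layers after the first one in `layeredTail s z i`. -/
def tailWeight {R : ℕ} (s : ℝ) (i : Fin R) : ℝ :=
  ∑ j ∈ Finset.Ioi i, s ^ (j - i : ℕ)

/-- Shows that the measurements of a tail can be computed from those of the whole message and the
earlier layers. -/
theorem smul_layeredTail {R n : ℕ} (s : ℝ) (z : Fin R → Fin n → ℝ) (i : Fin R) :
    s ^ (i : ℕ) • layeredTail s z i = ∑ j : Fin R, s ^ (j : ℕ) • z j - ∑ j ∈ Finset.Iio i,
      s ^ (j : ℕ) • z j := by
  classical
  rw [eq_sub_iff_add_eq, layeredTail, Finset.smul_sum]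
  have h : ∑ j ∈ Finset.Ici i, s ^ (i : ℕ) • s ^ (j - i : ℕ) • z j =
      ∑ j ∈ Finset.Ici i, s ^ (j : ℕ) • z j :=
    Finset.sum_congr rfl fun j hj => by
      have : i ≤ j := Finset.mem_Ici.1 hj
      rw [smul_smul, ← pow_add, Nat.add_sub_cancel' this]
  rw [h, ← Finset.sum_union]
  · refine Finset.sum_congr ?_ fun _ _ => rfl
    ext j
    simp [le_or_gt]
  · exact Finset.disjoint_left.2 fun j hj hj' =>
      (Finset.mem_Ici.1 hj).not_gt (Finset.mem_Iio.1 hj')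

theorem tailWeight_nonneg {R : ℕ} {s : ℝ} (hs : 0 ≤ s) (i : Fin R) : 0 ≤ tailWeight s i :=
  Finset.sum_nonneg fun _ _ => pow_nonneg hs _

theorem tailWeight_le {R : ℕ} {s : ℝ} (hs : 0 ≤ s) (hs' : s ≤ 1 / 2) (i : Fin R) :
    tailWeight s i ≤ 2 * s := by
  classical
  have h1 : tailWeight s i = ∑ l ∈ (Finset.Ioi i).image (fun j : Fin R => (j - i - 1 : ℕ)),
      s * s ^ l := by
    rw [Finset.sum_image]
    · refine Finset.sum_congr rfl fun j hj => ?_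
      have : i < j := Finset.mem_Ioi.1 hj
      rw [← pow_succ']
      congr 1
      omega
    · intro j hj j' hj' h
      have h2 : (i : ℕ) < j := by simpa using hj
      have h3 : (i : ℕ) < j' := by simpa using hj'
      simp only at h
      exact Fin.ext (by omega)
  have h2 : ∑ l ∈ (Finset.Ioi i).image (fun j : Fin R => (j - i - 1 : ℕ)), s * s ^ l ≤
      ∑ l ∈ Finset.range R, s * s ^ l := by
    refine Finset.sum_le_sum_of_subset_of_nonneg (fun l hl => ?_) fun _ _ _ => by positivity
    obtain ⟨j, -, rfl⟩ := Finset.mem_image.1 hl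
    have := j.2
    simp only [Finset.mem_range]
    omega
  have h3 := mul_neg_geom_sum s R
  have h4 : 0 ≤ s ^ R := pow_nonneg hs _
  have h5 : 0 ≤ ∑ l ∈ Finset.range R, s ^ l := Finset.sum_nonneg fun _ _ => pow_nonneg hs _
  simp only [← Finset.mul_sum] at h1 h2
  rw [h1]
  nlinarith

/-- Moving the weight of every later layer onto `z i` leaves only differences of layers, which stay
bounded even if the ball is far from the origin. -/
theorem layeredTail_sub_smul {R n : ℕ} (s : ℝ) (z : Fin R → Fin n → ℝ) (i : Fin R) :
    layeredTail s z i - (1 + tailWeight s i) • z i =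
      ∑ j ∈ Finset.Ioi i, s ^ (j - i : ℕ) • (z j - z i) := by
  simp_rw [layeredTail, tailWeight, smul_sub, Finset.sum_sub_distrib, add_smul, Finset.sum_smul,
    ← Finset.add_sum_Ioi_eq_sum_Ici]
  simp

/-- If all layers are close to each other then the superposition of the layers from `i` on is close
to a multiple of layer `i`. -/
theorem seminorm_layeredTail_sub_le {R n : ℕ} (N : Seminorm ℝ (Fin n → ℝ)) {s r η : ℝ}
    (hs : 0 ≤ s) (hs' : s ≤ 1 / 2) (hr : 0 ≤ r) (z : Fin R → Fin n → ℝ) (i : Fin R)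
    (hz : ∀ j, N (z j - z i) ≤ 2 * r) (u : Fin n → ℝ) (hu : N u ≤ η) :
    N (layeredTail s z i + u - (1 + tailWeight s i) • z i) ≤ 4 * s * r + η := by
  have h1 : layeredTail s z i + u - (1 + tailWeight s i) • z i =
      (∑ j ∈ Finset.Ioi i, s ^ (j - i : ℕ) • (z j - z i)) + u := by
    rw [← layeredTail_sub_smul]; abel
  have h2 : N (∑ j ∈ Finset.Ioi i, s ^ (j - i : ℕ) • (z j - z i)) ≤
      ∑ j ∈ Finset.Ioi i, s ^ (j - i : ℕ) * (2 * r) := by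
    refine (Finset.le_sum_of_subadditive N (map_zero N).le (map_add_le_add N) _ _).trans (Finset.sum_le_sum fun j _ => ?_)
    rw [map_smul_eq_mul, Real.norm_of_nonneg (pow_nonneg hs _)]
    exact mul_le_mul_of_nonneg_left (hz j) (pow_nonneg hs _)
  rw [← Finset.sum_mul] at h2
  have h3 := tailWeight_le hs hs' i
  have h4 : tailWeight s i * (2 * r) ≤ 2 * s * (2 * r) :=
    mul_le_mul_of_nonneg_right h3 (by positivity)
  rw [tailWeight] at h4
  rw [h1]
  linarith [map_add_le_add N (∑ j ∈ Finset.Ioi i, s ^ (j - i : ℕ) • (z j - z i)) u]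

/-- A message made of layers `y (g j)` of weights `s ^ j`, perturbed by `u`, is determined by its
linear image, given the layers outside `F`, if the decoder `D` succeeds in all layers of `F`. -/
theorem eq_of_mulVec_layered_eq {R n m : ℕ} {ι : Type*} (N : Seminorm ℝ (Fin n → ℝ))
    {s β γ ρ : ℝ} (hs : 0 < s) (hsep : 2 * (γ + β) ≤ ρ) (y : ι → Fin n → ℝ)
    (hy : ∀ a b, a ≠ b → ρ < N (y a - y b))
    (M : Matrix (Fin m) (Fin n) ℝ) (D : (Fin m → ℝ) → Fin n → ℝ) (F : Finset (Fin R))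
    (g g' : Fin R → ι) (u u' : Fin n → ℝ) (hgg : ∀ i ∉ F, g i = g' i)
    (hM : M *ᵥ (u + ∑ j : Fin R, s ^ (j : ℕ) • y (g j)) = M *ᵥ (u' + ∑ j : Fin R, s ^ (j : ℕ) • y (g' j)))
    (hg : ∀ i ∈ F, N (layeredTail s (y ∘ g) i + (s ^ (i : ℕ))⁻¹ • u -
      (1 + tailWeight s i) • y (g i)) ≤ β)
    (hg' : ∀ i ∈ F, N (layeredTail s (y ∘ g') i + (s ^ (i : ℕ))⁻¹ • u' -
      (1 + tailWeight s i) • y (g' i)) ≤ β)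
    (hD : ∀ i ∈ F, N (layeredTail s (y ∘ g) i + (s ^ (i : ℕ))⁻¹ • u -
      D (M *ᵥ (layeredTail s (y ∘ g) i + (s ^ (i : ℕ))⁻¹ • u))) ≤ γ)
    (hD' : ∀ i ∈ F, N (layeredTail s (y ∘ g') i + (s ^ (i : ℕ))⁻¹ • u' -
      D (M *ᵥ (layeredTail s (y ∘ g') i + (s ^ (i : ℕ))⁻¹ • u'))) ≤ γ) :
    g = g' := by
  -- Layers are decoded from the heaviest on. An earlier layer is known either by induction or,
  -- outside `F`, by assumption.
  have key : ∀ (t : ℕ) (i : Fin R), (i : ℕ) = t → g i = g' i := by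
    intro t
    induction t using Nat.strong_induction_on with
    | _ t ih =>
    intro i hi
    by_cases hiF : i ∈ F
    swap
    · exact hgg i hiF
    have hprev : ∑ j ∈ Finset.Iio i, s ^ (j : ℕ) • y (g j) =
        ∑ j ∈ Finset.Iio i, s ^ (j : ℕ) • y (g' j) :=
      Finset.sum_congr rfl fun j hj => by
        have : j < i := Finset.mem_Iio.1 hj
        rw [ih j (by omega) j rfl]
    have hsi : s ^ (i : ℕ) ≠ 0 := (pow_pos hs _).ne'
    have hform : ∀ (h : Fin R → ι) (w : Fin n → ℝ),
        layeredTail s (y ∘ h) i + (s ^ (i : ℕ))⁻¹ • w = (s ^ (i : ℕ))⁻¹ •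
          ((w + ∑ j : Fin R, s ^ (j : ℕ) • y (h j)) - ∑ j ∈ Finset.Iio i, s ^ (j : ℕ) • y (h j)) := by
      intro h w
      rw [eq_inv_smul_iff₀ hsi, smul_add, smul_inv_smul₀ hsi, smul_layeredTail]
      simp only [Function.comp_apply]
      abel
    have hMi : M *ᵥ (layeredTail s (y ∘ g) i + (s ^ (i : ℕ))⁻¹ • u) =
        M *ᵥ (layeredTail s (y ∘ g') i + (s ^ (i : ℕ))⁻¹ • u') := by
      rw [hform g u, hform g' u', Matrix.mulVec_smul, Matrix.mulVec_smul, Matrix.mulVec_sub,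
        Matrix.mulVec_sub, hM, hprev]
    by_contra hne
    have h1 := hg i hiF
    have h2 := hg' i hiF
    have h3 := hD i hiF
    have h4 := hD' i hiF
    rw [← hMi] at h4
    set v := D (M *ᵥ (layeredTail s (y ∘ g) i + (s ^ (i : ℕ))⁻¹ • u))
    set X := layeredTail s (y ∘ g) i + (s ^ (i : ℕ))⁻¹ • u
    set X' := layeredTail s (y ∘ g') i + (s ^ (i : ℕ))⁻¹ • u'
    -- Both tails have the same image, hence the same decoded vector `v`. The factor `1 + tailWeight
    -- s i` does not depend on the message and is at least one, so it preserves the separation.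
    have h5 : N ((1 + tailWeight s i) • (y (g i) - y (g' i))) ≤ 2 * (γ + β) := by
      have e : (1 + tailWeight s i) • (y (g i) - y (g' i)) =
          ((X - v) - (X - (1 + tailWeight s i) • y (g i))) -
          ((X' - v) - (X' - (1 + tailWeight s i) • y (g' i))) := by
        rw [smul_sub]; abel
      rw [e]
      linarith [map_sub_le_add N ((X - v) - (X - (1 + tailWeight s i) • y (g i)))
        ((X' - v) - (X' - (1 + tailWeight s i) • y (g' i))),
        map_sub_le_add N (X - v) (X - (1 + tailWeight s i) • y (g i)),
        map_sub_le_add N (X' - v) (X' - (1 + tailWeight s i) • y (g' i))]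
    have h6 := tailWeight_nonneg hs.le i
    rw [map_smul_eq_mul, Real.norm_of_nonneg (by linarith)] at h5
    have h7 := hy _ _ hne
    have h8 : 0 ≤ N (y (g i) - y (g' i)) := apply_nonneg _ _
    nlinarith
  exact funext fun i => key i i rfl

/-! ### Averaging over the seed and counting messages -/

/-- If finitely many events have conditional probability at least `3/4` given every point of `Q`,
then for some seed their total measure over `Q` is at least `3/4` of the maximum. -/
theorem exists_seed_three_mul_card_mul_le {Ω α J : Type*} [MeasurableSpace Ω] [MeasurableSpace α]
    [Fintype J] (P : Measure Ω) [IsProbabilityMeasure P] (μ : Measure α) [SFinite μ]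
    (Q : Set α) (hQ : MeasurableSet Q) (hQ' : μ Q ≠ ⊤) (E : J → Set (Ω × α))
    (hE : ∀ j, MeasurableSet (E j))
    (hP : ∀ j, ∀ u ∈ Q, 3 ≤ 4 * P ((fun ω => (ω, u)) ⁻¹' E j)) :
    ∃ ω, 3 * (Fintype.card J * μ Q) ≤ 4 * ∑ j, μ (Q ∩ Prod.mk ω ⁻¹' E j) := by
  have hr : ∀ ω j, μ.restrict Q (Prod.mk ω ⁻¹' E j) = μ (Q ∩ Prod.mk ω ⁻¹' E j) := fun ω j => by
    rw [Measure.restrict_apply' hQ, Set.inter_comm]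
  have hm : ∀ j, Measurable fun ω => μ.restrict Q (Prod.mk ω ⁻¹' E j) := fun j =>
    measurable_measure_prodMk_left (hE j)
  have hint : ∀ j, ∫⁻ ω, μ.restrict Q (Prod.mk ω ⁻¹' E j) ∂P =
      ∫⁻ u in Q, P ((fun ω => (ω, u)) ⁻¹' E j) ∂μ := fun j => by
    rw [← Measure.prod_apply (hE j), Measure.prod_apply_symm (hE j)]
  have hlow : ∀ j, 3 * μ Q ≤ ∫⁻ ω, 4 * μ.restrict Q (Prod.mk ω ⁻¹' E j) ∂P := fun j => by
    rw [lintegral_const_mul _ (hm j), hint, ← lintegral_const_mul _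
      (measurable_measure_prodMk_right (hE j)), ← setLIntegral_const]
    exact setLIntegral_mono' hQ fun u hu => hP j u hu
  have hfin : ∫⁻ ω, 4 * ∑ j, μ.restrict Q (Prod.mk ω ⁻¹' E j) ∂P ≠ ⊤ := by
    refine ne_top_of_le_ne_top (b := 4 * ∑ _j : J, μ Q) ?_ ?_
    · exact ENNReal.mul_ne_top (by simp) (ENNReal.sum_ne_top.2 fun _ _ => hQ')
    · refine (lintegral_mono fun ω => ?_).trans_eq (by rw [lintegral_const, measure_univ, mul_one])
      refine mul_le_mul_right (Finset.sum_le_sum fun j _ => ?_) 4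
      rw [hr]
      exact measure_mono Set.inter_subset_left
  obtain ⟨ω, hω⟩ := exists_lintegral_le hfin
  refine ⟨ω, ?_⟩
  simp only [hr] at hω
  refine le_trans ?_ hω
  simp_rw [Finset.mul_sum]
  rw [lintegral_finsetSum _ fun j _ => by
    simpa only [hr] using (hm j).const_mul 4]
  calc 3 * (Fintype.card J * μ Q) = ∑ _j : J, 3 * μ Q := by
        rw [Finset.sum_const, Finset.card_univ, nsmul_eq_mul]; ring
    _ ≤ _ := Finset.sum_le_sum fun j _ => by simpa only [hr] using hlow j

/-- If `2 q` events have total measure at least `3/4` of the maximum, then the event that at least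
half of them occur is bounded below. -/
theorem sum_measure_le_of_majority {α : Type*} [MeasurableSpace α] (μ : Measure α) {q : ℕ}
    (Q : Set α) (hQ : MeasurableSet Q) (G : Fin (2 * q) → Set α)
    (hG : ∀ i, MeasurableSet (G i)) (hGQ : ∀ i, G i ⊆ Q) :
    ∑ i, μ (G i) ≤ 2 * q * ∑ F : {F : Finset (Fin (2 * q)) // q ≤ F.card},
      μ (Q ∩ ⋂ i ∈ F.1, G i) + q * μ Q := by
  classical
  let E : Set α := ⋃ F : {F : Finset (Fin (2 * q)) // q ≤ F.card}, Q ∩ ⋂ i ∈ F.1, G i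
  have hE : MeasurableSet E := MeasurableSet.iUnion fun F =>
    hQ.inter (Finset.measurableSet_biInter _ fun i _ => hG i)
  have hEle : μ E ≤ ∑ F : {F : Finset (Fin (2 * q)) // q ≤ F.card}, μ (Q ∩ ⋂ i ∈ F.1, G i) :=
    measure_iUnion_fintype_le μ _
  -- At most `2 * q` events occur at a point of `E`, and fewer than `q` at any other point of `Q`.
  have hpt : ∀ u, ∑ i, (G i).indicator (1 : α → ENNReal) u ≤
      2 * q * E.indicator 1 u + q * Q.indicator 1 u := by
    intro u
    have hsum : ∑ i, (G i).indicator (1 : α → ENNReal) u =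
        ((Finset.univ.filter fun i => u ∈ G i).card : ENNReal) := by
      simp [Set.indicator_apply]
    rw [hsum]
    by_cases hc : q ≤ (Finset.univ.filter fun i => u ∈ G i).card
    · rcases Nat.eq_zero_or_pos q with rfl | hq
      · simp
      have huQ : u ∈ Q := by
        obtain ⟨i, hi⟩ := Finset.card_pos.1 (hq.trans_le hc)
        exact hGQ i (Finset.mem_filter.1 hi).2
      have huE : u ∈ E := Set.mem_iUnion.2 ⟨⟨_, hc⟩, huQ, by simp⟩
      have h2 : ((Finset.univ.filter fun i => u ∈ G i).card : ENNReal) ≤ 2 * q := by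
        have := Finset.card_le_univ (Finset.univ.filter fun i => u ∈ G i)
        rw [Fintype.card_fin] at this
        exact_mod_cast this
      simpa [huE] using h2.trans le_self_add
    · rw [not_le] at hc
      by_cases huQ : u ∈ Q
      · have : ((Finset.univ.filter fun i => u ∈ G i).card : ENNReal) ≤ q := by
          exact_mod_cast hc.le
        simpa [huQ] using this.trans le_add_self
      · have : (Finset.univ.filter fun i => u ∈ G i) = ∅ :=
          Finset.filter_eq_empty_iff.2 fun i _ hi => huQ (hGQ i hi)
        simp [this]
  calc ∑ i, μ (G i) = ∫⁻ u, ∑ i, (G i).indicator 1 u ∂μ := by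
        rw [lintegral_finsetSum _ fun i _ => measurable_one.indicator (hG i)]
        simp_rw [lintegral_indicator_one (hG _)]
    _ ≤ ∫⁻ u, 2 * q * E.indicator 1 u + q * Q.indicator 1 u ∂μ := lintegral_mono hpt
    _ = 2 * q * μ E + q * μ Q := by
        rw [lintegral_add_left ((measurable_one.indicator hE).const_mul _),
          lintegral_const_mul _ (measurable_one.indicator hE),
          lintegral_const_mul _ (measurable_one.indicator hQ), lintegral_indicator_one hE,
          lintegral_indicator_one hQ]
    _ ≤ _ := by gcongr

/-- Counting of messages of `2 q` layers over the alphabet `ι`: if the decodings succeed in `3/4` of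
the cases, and the messages with prescribed layers outside any `F` that are decoded in all of `F`
have total measure at most `V`, then there are not too many messages. -/
theorem card_pow_mul_measure_le {α ι : Type*} [MeasurableSpace α] [Fintype ι] [Nonempty ι] (μ : Measure α)
    {q : ℕ} (hq : 0 < q) (Q : Set α) (hQ : MeasurableSet Q) (hQ' : μ Q ≠ ⊤)
    (G : (Fin (2 * q) → ι) → Fin (2 * q) → Set α) (hG : ∀ g i, MeasurableSet (G g i))
    (hGQ : ∀ g i, G g i ⊆ Q)
    (h34 : 3 * ((Fintype.card ι ^ (2 * q) * (2 * q) : ℕ) * μ Q) ≤ 4 * ∑ g, ∑ i, μ (G g i))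
    (V : ENNReal)
    (hV : ∀ (F : Finset (Fin (2 * q))) (I : Finset (Fin (2 * q) → ι)),
      (∀ g ∈ I, ∀ g' ∈ I, ∀ i ∉ F, g i = g' i) → ∑ g ∈ I, μ (Q ∩ ⋂ i ∈ F, G g i) ≤ V) :
    (Fintype.card ι : ENNReal) ^ (2 * q) * μ Q ≤
      4 * (4 ^ q * (Fintype.card ι : ENNReal) ^ q * V) := by
  classical
  set l := Fintype.card ι
  let W := ∑ g : Fin (2 * q) → ι, ∑ F : {F : Finset (Fin (2 * q)) // q ≤ F.card},
    μ (Q ∩ ⋂ i ∈ F.1, G g i)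
  have hW : W ≤ 4 ^ q * (l : ENNReal) ^ q * V := by
    have hF : ∀ F : {F : Finset (Fin (2 * q)) // q ≤ F.card},
        ∑ g, μ (Q ∩ ⋂ i ∈ F.1, G g i) ≤ (l : ENNReal) ^ q * V := by
      intro F
      -- Messages are grouped by their layers outside `F`. There are at most `q` such layers, so at
      -- most `l ^ q` groups.
      let ρ : (Fin (2 * q) → ι) → ((F.1ᶜ : Finset (Fin (2 * q))) → ι) := fun g i => g i
      rw [← Finset.sum_fiberwise Finset.univ ρ]
      refine (Finset.sum_le_sum (g := fun _ => V) fun h _ => hV F.1 _ ?_).trans ?_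
      · intro g hg g' hg' i hi
        have h1 := (Finset.mem_filter.1 hg).2
        have h2 := (Finset.mem_filter.1 hg').2
        exact congrFun (h1.trans h2.symm) ⟨i, Finset.mem_compl.2 hi⟩
      · rw [Finset.sum_const, Finset.card_univ, nsmul_eq_mul, Fintype.card_fun]
        gcongr
        rw [← Nat.cast_pow, Nat.cast_le]
        refine Nat.pow_le_pow_right Fintype.card_pos ?_
        have := F.2
        rw [Fintype.card_coe, Finset.card_compl, Fintype.card_fin]
        omega
    calc W = ∑ F : {F : Finset (Fin (2 * q)) // q ≤ F.card}, ∑ g, μ (Q ∩ ⋂ i ∈ F.1, G g i) :=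
          Finset.sum_comm
      _ ≤ ∑ F : {F : Finset (Fin (2 * q)) // q ≤ F.card}, (l : ENNReal) ^ q * V :=
          Finset.sum_le_sum fun F _ => hF F
      _ ≤ _ := by
          rw [Finset.sum_const, Finset.card_univ, nsmul_eq_mul, mul_assoc]
          gcongr
          have : Fintype.card {F : Finset (Fin (2 * q)) // q ≤ F.card} ≤ 4 ^ q :=
            (Fintype.card_subtype_le _).trans (by simp [pow_mul])
          exact_mod_cast this
  have h1 : ∑ g, ∑ i, μ (G g i) ≤ 2 * q * W + (l ^ (2 * q) : ℕ) * (q * μ Q) := by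
    calc ∑ g, ∑ i, μ (G g i) ≤ ∑ g : Fin (2 * q) → ι,
          (2 * q * ∑ F : {F : Finset (Fin (2 * q)) // q ≤ F.card},
            μ (Q ∩ ⋂ i ∈ F.1, G g i) + q * μ Q) :=
          Finset.sum_le_sum fun g _ => sum_measure_le_of_majority μ Q hQ (G g) (hG g) (hGQ g)
      _ = _ := by
          rw [Finset.sum_add_distrib, ← Finset.mul_sum, Finset.sum_const, Finset.card_univ,
            Fintype.card_fun, Fintype.card_fin, nsmul_eq_mul]
  have hWtop : W ≠ ⊤ := ENNReal.sum_ne_top.2 fun g _ => ENNReal.sum_ne_top.2 fun F _ =>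
    ne_top_of_le_ne_top hQ' (measure_mono Set.inter_subset_left)
  refine le_trans ?_ (mul_le_mul_right hW 4)
  have h2 := h34.trans (mul_le_mul_right h1 4)
  generalize μ Q = x at *
  generalize W = w at *
  lift x to NNReal using hQ'
  lift w to NNReal using hWtop
  have h3 : 3 * ((l ^ (2 * q) * (2 * q) : ℕ) * x) ≤ 4 * (2 * q * w + (l ^ (2 * q) : ℕ) * (q * x)) := by
    exact_mod_cast h2
  -- The coefficient `3 * 2q` on the left exceeds the `4 * q` on the right by `2q`, to be compared
  -- with the `8q` in front of `w`.
  have h4 : (l : NNReal) ^ (2 * q) * x ≤ 4 * w := by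
    have hq' : (0 : ℝ) < q := by exact_mod_cast hq
    rw [← NNReal.coe_le_coe] at h3 ⊢
    push_cast at h3 ⊢
    refine le_of_mul_le_mul_left ?_ hq'
    nlinarith
  exact_mod_cast h4

/-! ### Sparse errors, measurability, the noise box, and a limit of powers -/

theorem IsSparse.smul {n k : ℕ} {x : Fin n → ℝ} (hx : IsSparse k x) (a : ℝ) :
    IsSparse k (a • x) :=
  (Set.ncard_le_ncard (Function.support_const_smul_subset a x) (Set.toFinite _)).trans hx

theorem sparseError_le {n k : ℕ} (N : Seminorm ℝ (Fin n → ℝ)) (x : Fin n → ℝ) {x' : Fin n → ℝ}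
    (hx' : IsSparse k x') : sparseError N k x ≤ N (x - x') :=
  ciInf_le (f := fun z : {z : Fin n → ℝ // IsSparse k z} => N (x - z))
    ⟨0, by rintro _ ⟨z, rfl⟩; exact apply_nonneg _ _⟩ ⟨x', hx'⟩

theorem seminorm_continuous {n : ℕ} (N : Seminorm ℝ (Fin n → ℝ)) : Continuous N :=
  continuousOn_univ.1 (N.convexOn.continuousOn isOpen_univ)

theorem exists_pos_seminorm_le {n : ℕ} (N : Seminorm ℝ (Fin n → ℝ)) {η : ℝ} (hη : 0 < η) :
    ∃ δ : ℝ, 0 < δ ∧ ∀ u : Fin n → ℝ, (∀ j, 0 ≤ u j ∧ u j ≤ δ) → N u ≤ η := by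
  obtain ⟨ε, hε, h⟩ := Metric.continuousAt_iff.1
    ((seminorm_continuous N).continuousAt (x := (0 : Fin n → ℝ))) η hη
  refine ⟨ε / 2, by positivity, fun u hu => ?_⟩
  have h1 : dist u 0 < ε := by
    refine lt_of_le_of_lt ?_ (half_lt_self hε)
    refine (dist_pi_le_iff (by positivity)).2 fun j => ?_
    rw [Pi.zero_apply, Real.dist_eq, sub_zero, abs_of_nonneg (hu j).1]
    exact (hu j).2
  have h2 := h h1
  rw [map_zero, Real.dist_eq, sub_zero] at h2
  exact (le_abs_self _).trans h2.le

theorem measurableSet_recover {Ω : Type*} [MeasurableSpace Ω] {m n : ℕ} (A : LinearScheme Ω m n)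
    (N : Seminorm ℝ (Fin n → ℝ)) (X : (Fin n → ℝ) → Fin n → ℝ) (hX : Measurable X) (γ : ℝ) :
    MeasurableSet {q : Ω × (Fin n → ℝ) |
      N (X q.2 - A.recover q.1 (A.mat q.1 *ᵥ X q.2)) ≤ γ} := by
  have hX' : Measurable fun q : Ω × (Fin n → ℝ) => X q.2 := hX.comp measurable_snd
  have h1 : Measurable fun q : Ω × (Fin n → ℝ) => A.mat q.1 *ᵥ X q.2 := by
    refine measurable_pi_lambda _ fun i => ?_
    simp only [Matrix.mulVec, dotProduct]
    refine Finset.measurable_fun_sum (f := fun j (q : Ω × (Fin n → ℝ)) =>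
      A.mat q.1 i j * X q.2 j) _ fun j _ => ?_
    exact ((A.measurable_mat i j).comp measurable_fst).mul ((measurable_pi_apply j).comp hX')
  have h2 : Measurable fun q : Ω × (Fin n → ℝ) => A.recover q.1 (A.mat q.1 *ᵥ X q.2) :=
    A.measurable_recover.comp (measurable_fst.prodMk h1)
  exact measurableSet_le ((seminorm_continuous N).measurable.comp (hX'.sub h2)) measurable_const

/-- On an input that is within `β` of a sparse vector, recovery errs by at most `K β` with
probability `3 / 4`. -/
theorem LinearScheme.RecoversNonneg.three_le {Ω : Type*} [MeasurableSpace Ω] {m n k : ℕ}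
    {A : LinearScheme Ω m n} {P : Measure Ω} [IsProbabilityMeasure P]
    {N : Seminorm ℝ (Fin n → ℝ)} {K : ℝ} (hA : A.RecoversNonneg P N k K) (hK : 0 ≤ K)
    {x x' : Fin n → ℝ} {β : ℝ} (hx : ∀ i, 0 ≤ x i) (hx' : IsSparse k x') (hβ : N (x - x') ≤ β) :
    3 ≤ 4 * P {ω | N (x - A.recover ω (A.mat ω *ᵥ x)) ≤ K * β} := by
  have h1 : 3 / 4 ≤ P.real {ω | N (x - A.recover ω (A.mat ω *ᵥ x)) ≤ K * β} :=
    (hA x hx).trans (measureReal_mono fun ω hω => le_trans (Set.mem_ofPred.1 hω)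
      (mul_le_mul_of_nonneg_left ((sparseError_le N x hx').trans hβ) hK))
  have h2 := ENNReal.ofReal_le_ofReal h1
  rw [ofReal_measureReal] at h2
  refine le_trans ?_ (mul_le_mul_right h2 4)
  rw [← ENNReal.ofReal_ofNat 4, ← ENNReal.ofReal_mul (by norm_num)]
  norm_num

/-- The box of side `δ`, extended by `L` in both directions along the coordinates in `S`. -/
theorem volume_extended_box_le {m n : ℕ} (S : Finset (Fin n)) (hS : S.card ≤ m) {L δ : ℝ}
    (hL : 0 ≤ L) (hδ : 0 < δ) :
    volume (Set.Icc (fun i => if i ∈ S then -L else 0) (fun i => if i ∈ S then L + δ else δ) :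
      Set (Fin n → ℝ)) ≤ ENNReal.ofReal (((2 * L + δ) / δ) ^ m) *
        volume (Set.Icc 0 (fun _ => δ) : Set (Fin n → ℝ)) := by
  have h1 : ∀ i, ENNReal.ofReal ((if i ∈ S then L + δ else δ) - (if i ∈ S then -L else 0)) =
      (if i ∈ S then ENNReal.ofReal ((2 * L + δ) / δ) else 1) * ENNReal.ofReal δ := fun i => by
    split_ifs
    · rw [← ENNReal.ofReal_mul (by positivity), div_mul_cancel₀ _ hδ.ne']
      congr 1; ring
    · simp
  rw [Real.volume_Icc_pi, Real.volume_Icc_pi]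
  simp_rw [h1, Finset.prod_mul_distrib, Pi.zero_apply, sub_zero]
  gcongr
  rw [Finset.prod_ite_mem, Finset.univ_inter, Finset.prod_const, ENNReal.ofReal_pow (by positivity)]
  refine pow_le_pow_right₀ ?_ hS
  rw [ENNReal.one_le_ofReal, le_div_iff₀ hδ]
  linarith

theorem sum_pow_fin_le_two {R : ℕ} {s : ℝ} (hs : 0 ≤ s) (hs' : s ≤ 1 / 2) :
    ∑ j : Fin R, s ^ (j : ℕ) ≤ 2 := by
  rw [Fin.sum_univ_eq_sum_range (fun j => s ^ j)]
  have h3 := mul_neg_geom_sum s R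
  have h4 : 0 ≤ s ^ R := pow_nonneg hs _
  have h5 : 0 ≤ ∑ l ∈ Finset.range R, s ^ l := Finset.sum_nonneg fun _ _ => pow_nonneg hs _
  nlinarith

/-- Otherwise `(a / b) ^ q` would outgrow `C`. This discards every constant that does not grow with
the number of layers. -/
theorem le_of_forall_pow_le_mul_pow {a b C : ℝ} (hb : 0 < b)
    (h : ∀ q : ℕ, 0 < q → a ^ q ≤ C * b ^ q) : a ≤ b := by
  by_contra! hab
  obtain ⟨q, hq⟩ := pow_unbounded_of_one_lt (max C 1) ((one_lt_div hb).2 hab)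
  have hq0 : 0 < q := by
    rcases Nat.eq_zero_or_pos q with rfl | h
    · have := le_max_right C 1
      rw [pow_zero] at hq
      linarith
    · exact h
  rw [div_pow, lt_div_iff₀ (pow_pos hb q)] at hq
  have := mul_le_mul_of_nonneg_right (le_max_left C 1) (pow_pos hb q).le
  linarith [h q hq0]

/-! ### Bounding the number of separated sparse vectors -/

/-- The bound on the number of separated sparse vectors that follows from superposing `2 q` of
them. -/
theorem card_pow_le_of_recoversNonneg {Ω ι : Type*} [MeasurableSpace Ω] [Fintype ι] [Nonempty ι]
    {m n k : ℕ} {A : LinearScheme Ω m n} {P : Measure Ω} [IsProbabilityMeasure P]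
    {N : Seminorm ℝ (Fin n → ℝ)} {K : ℝ} (hA : A.RecoversNonneg P N k K) (hK : 0 < K)
    {r : ℝ} (hr : 0 < r) (y : ι → Fin n → ℝ) (hy : ∀ a, y a ∈ nonnegSparse n k)
    (hclose : ∀ a b, N (y a - y b) ≤ 2 * r) (hsep : ∀ a b, a ≠ b → r / 2 < N (y a - y b))
    {ρ : ℝ} (hρ : 0 ≤ ρ) (hyρ : ∀ a j, y a j ≤ ρ) {δ₀ : ℝ} (hδ₀ : 0 < δ₀)
    (hNδ₀ : ∀ u : Fin n → ℝ, (∀ j, 0 ≤ u j ∧ u j ≤ δ₀) → N u ≤ r / (16 * (K + 1)))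
    {q : ℕ} (hq : 0 < q) :
    (Fintype.card ι : ℝ) ^ q ≤
      4 * (4 ^ q * ((2 * (m * (n * (2 * ρ))) / δ₀ + 1) * (32 * (K + 1)) ^ (2 * q)) ^ m) := by
  classical
  -- With this `s` a tail is within `4 * s * r + r / (16 * (K + 1))`, that is `3 / 16 * (r / (K +
  -- 1))`, of a sparse vector. This is below `β`, and `2 * (K * β + β) = 2 / 5 * r` is below the
  -- separation `r / 2`.
  obtain ⟨s, hs⟩ : ∃ s, s = (32 * (K + 1))⁻¹ := ⟨_, rfl⟩
  have hs0 : 0 < s := by rw [hs]; positivity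
  have hs2 : s ≤ 1 / 2 := by
    rw [hs, one_div]
    exact inv_anti₀ two_pos (by linarith)
  -- Isolating layer `i < 2 * q` magnifies the noise by `s⁻¹ ^ i`; it must still be at most `δ₀`.
  obtain ⟨δ, hδ⟩ : ∃ δ, δ = δ₀ * s ^ (2 * q) := ⟨_, rfl⟩
  have hδ0 : 0 < δ := by rw [hδ]; positivity
  let β := r / (5 * (K + 1))
  let L : ℝ := m * (n * (2 * ρ))
  let Q : Set (Fin n → ℝ) := Set.Icc 0 (fun _ => δ)
  have hQm : MeasurableSet Q := measurableSet_Icc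
  have hQv : volume Q = ENNReal.ofReal δ ^ n := by
    simp [Q, Real.volume_Icc_pi]
  have hQtop : volume Q ≠ ⊤ := by rw [hQv]; exact ENNReal.pow_ne_top ENNReal.ofReal_ne_top
  have hQ0 : volume Q ≠ 0 := by
    rw [hQv]; exact pow_ne_zero _ (by simpa using hδ0)
  let X : (Fin (2 * q) → ι) → Fin (2 * q) → (Fin n → ℝ) → Fin n → ℝ := fun g i u =>
    layeredTail s (y ∘ g) i + (s ^ (i : ℕ))⁻¹ • u
  have hXm : ∀ g i, Measurable (X g i) := fun g i =>
    by fun_prop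
  have hclose' : ∀ g i, ∀ u ∈ Q, N (X g i u - (1 + tailWeight s i) • y (g i)) ≤ β := by
    intro g i u hu
    refine (seminorm_layeredTail_sub_le N hs0.le hs2 hr.le (y ∘ g) i (fun j => hclose _ _) _
      (hNδ₀ _ fun j => ⟨?_, ?_⟩)).trans ?_
    · exact mul_nonneg (inv_nonneg.2 (pow_nonneg hs0.le _)) (hu.1 j)
    · have h1 : u j ≤ δ₀ * s ^ (2 * q) := hδ ▸ hu.2 j
      have h2 : s ^ (2 * q) ≤ s ^ (i : ℕ) :=
        pow_le_pow_of_le_one hs0.le (by linarith) i.2.le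
      rw [Pi.smul_apply, smul_eq_mul, inv_mul_le_iff₀ (pow_pos hs0 _)]
      nlinarith
    · have : 4 * s * r + r / (16 * (K + 1)) = 3 / 16 * (r / (K + 1)) := by
        rw [hs]; field_simp; norm_num
      have h5 : β = 1 / 5 * (r / (K + 1)) := by simp only [β]; field_simp
      have : 0 < r / (K + 1) := by positivity
      linarith
  have hXnonneg : ∀ g i, ∀ u ∈ Q, ∀ j, 0 ≤ X g i u j := by
    intro g i u hu j
    refine add_nonneg ?_ (mul_nonneg (inv_nonneg.2 (pow_nonneg hs0.le _)) (hu.1 j))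
    rw [layeredTail, Finset.sum_apply]
    exact Finset.sum_nonneg fun l _ => mul_nonneg (pow_nonneg hs0.le _) ((hy _).1 j)
  let E : (Fin (2 * q) → ι) × Fin (2 * q) → Set (Ω × (Fin n → ℝ)) := fun p =>
    {z | N (X p.1 p.2 z.2 - A.recover z.1 (A.mat z.1 *ᵥ X p.1 p.2 z.2)) ≤ K * β}
  have hE : ∀ p, MeasurableSet (E p) := fun p =>
    measurableSet_recover A N (X p.1 p.2) (hXm _ _) _
  obtain ⟨ω, hω⟩ := exists_seed_three_mul_card_mul_le P volume Q hQm hQtop E hE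
    fun p u hu => hA.three_le hK.le (hXnonneg p.1 p.2 u hu) ((hy _).2.smul _)
      (hclose' p.1 p.2 u hu)
  obtain ⟨S, hS, hSv⟩ := exists_columns_supporting_image (A.mat ω)
  have hx : ∀ (g : Fin (2 * q) → ι) (j : Fin n),
      |(∑ i : Fin (2 * q), s ^ (i : ℕ) • y (g i)) j| ≤ 2 * ρ := by
    intro g j
    rw [Finset.sum_apply]
    simp only [Pi.smul_apply, smul_eq_mul]
    rw [abs_of_nonneg
      (Finset.sum_nonneg fun l _ => mul_nonneg (pow_nonneg hs0.le _) ((hy _).1 j))]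
    refine (Finset.sum_le_sum (g := fun i : Fin (2 * q) => s ^ (i : ℕ) * ρ) fun i _ =>
      mul_le_mul_of_nonneg_left (hyρ _ j) (pow_nonneg hs0.le _)).trans ?_
    rw [← Finset.sum_mul]
    exact mul_le_mul_of_nonneg_right (sum_pow_fin_le_two hs0.le hs2) hρ
  -- The seed is fixed, so the set `S` of columns is the same for all messages and the translates
  -- stay in one box.
  choose v hv0 hvL hvA using fun g => hSv (2 * ρ) _ (hx g)
  have hV := card_pow_mul_measure_le (ι := ι) volume hq Q hQm hQtop
    (fun g i => Q ∩ Prod.mk ω ⁻¹' E (g, i))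
    (fun g i => hQm.inter (measurable_prodMk_left (hE _))) (fun g i => Set.inter_subset_left)
    (by
      rw [Fintype.sum_prod_type, Fintype.card_prod, Fintype.card_fun, Fintype.card_fin] at hω
      exact hω)
    (volume (Set.Icc (fun i => if i ∈ S then -L else 0) (fun i => if i ∈ S then L + δ else δ) :
      Set (Fin n → ℝ)))
    (fun F I hI => sum_measure_le_of_disjoint_translates volume I _
      (fun g _ => hQm.inter (Finset.measurableSet_biInter _ fun i _ =>
        hQm.inter (measurable_prodMk_left (hE _)))) v _
      (fun g _ u hu => by
        have huQ : u ∈ Q := hu.1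
        rw [Set.mem_Icc, Pi.le_def, Pi.le_def]
        refine ⟨fun j => ?_, fun j => ?_⟩
        all_goals
          have h1 := huQ.1 j
          have h2 := huQ.2 j
          have h3 := abs_le.1 (hvL g j)
          have h4 := hv0 g j
          simp only [Pi.zero_apply] at h1
          rw [Pi.add_apply]
          split_ifs with hj
          · simp only [L]; linarith
          · rw [h4 hj]; linarith)
      (fun g hg g' hg' u hu u' hu' huv => by
        have hmem : ∀ {g u}, u ∈ Q ∩ ⋂ i ∈ F, Q ∩ Prod.mk ω ⁻¹' E (g, i) → ∀ i ∈ F,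
            N (X g i u - A.recover ω (A.mat ω *ᵥ X g i u)) ≤ K * β := fun hu i hi =>
          (Set.mem_iInter₂.1 hu.2 i hi).2
        refine eq_of_mulVec_layered_eq N (γ := K * β) (β := β) (ρ := r / 2) hs0 ?_ y hsep
          (A.mat ω) (A.recover ω) F g g' u u' (hI g hg g' hg') ?_
          (fun i _ => hclose' g i u hu.1) (fun i _ => hclose' g' i u' hu'.1)
          (hmem hu) (hmem hu')
        · have : 2 * (K * β + β) = 2 / 5 * r := by simp only [β]; field_simp
          linarith
        · rw [Matrix.mulVec_add, Matrix.mulVec_add, ← hvA g, ← hvA g', ← Matrix.mulVec_add,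
            ← Matrix.mulVec_add, huv]))
  have hbox := volume_extended_box_le S hS (L := L) (by positivity) hδ0
  have h1 := hV.trans (mul_le_mul_right (mul_le_mul_right hbox _) _)
  have h2 : (Fintype.card ι : ENNReal) ^ (2 * q) ≤ 4 * (4 ^ q * (Fintype.card ι : ENNReal) ^ q *
      ENNReal.ofReal (((2 * L + δ) / δ) ^ m)) := by
    rw [← ENNReal.mul_le_mul_iff_left hQ0 hQtop]
    refine h1.trans_eq ?_
    simp only [Q]
    ring
  have h3 : (Fintype.card ι : ℝ) ^ (2 * q) ≤ 4 * (4 ^ q * (Fintype.card ι : ℝ) ^ q *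
      ((2 * L + δ) / δ) ^ m) := by
    have hnn : 0 ≤ (2 * L + δ) / δ := by positivity
    have := ENNReal.toReal_mono (by finiteness) h2
    simpa [ENNReal.toReal_mul, ENNReal.toReal_pow, ENNReal.toReal_ofReal (pow_nonneg hnn m)]
      using this
  have hcard : (0 : ℝ) < Fintype.card ι := by exact_mod_cast Fintype.card_pos
  -- Of the `2 * q` layers, the `q` given away cancel.
  have h4 : (Fintype.card ι : ℝ) ^ q ≤ 4 * (4 ^ q * ((2 * L + δ) / δ) ^ m) := by
    refine le_of_mul_le_mul_right ?_ (pow_pos hcard q)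
    rw [← pow_add, ← two_mul]
    exact h3.trans_eq (by ring)
  refine h4.trans ?_
  have h5 : (2 * L + δ) / δ ≤ (2 * L / δ₀ + 1) * (32 * (K + 1)) ^ (2 * q) := by
    have e1 : (32 * (K + 1)) = s⁻¹ := by rw [hs, inv_inv]
    have e2 : (1 : ℝ) ≤ (s⁻¹) ^ (2 * q) :=
      one_le_pow₀ ((one_le_inv₀ hs0).2 (by linarith))
    have e3 : (2 * L + δ) / δ = 2 * L / δ₀ * (s⁻¹) ^ (2 * q) + 1 := by
      rw [hδ, inv_pow]; field_simp
    rw [e1, e3, add_mul, one_mul]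
    linarith
  gcongr

/-- Superposing more and more layers: a recovery scheme bounds the number of separated sparse
vectors. -/
theorem card_le_of_recoversNonneg {Ω ι : Type*} [MeasurableSpace Ω] [Fintype ι] [Nonempty ι]
    {m n k : ℕ} {A : LinearScheme Ω m n} {P : Measure Ω} [IsProbabilityMeasure P]
    {N : Seminorm ℝ (Fin n → ℝ)} {K : ℝ} (hA : A.RecoversNonneg P N k K) (hK : 0 < K)
    {r : ℝ} (hr : 0 < r) (y : ι → Fin n → ℝ) (hy : ∀ a, y a ∈ nonnegSparse n k)
    (hclose : ∀ a b, N (y a - y b) ≤ 2 * r) (hsep : ∀ a b, a ≠ b → r / 2 < N (y a - y b)) :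
    (Fintype.card ι : ℝ) ≤ 4 * (32 * (K + 1)) ^ (2 * m) := by
  obtain ⟨δ₀, hδ₀, hNδ₀⟩ := exists_pos_seminorm_le N (η := r / (16 * (K + 1))) (by positivity)
  let ρ : ℝ := ∑ a, ∑ j, y a j
  have hnn : ∀ a j, 0 ≤ y a j := fun a => (hy a).1
  have hρ : 0 ≤ ρ := Finset.sum_nonneg fun a _ => Finset.sum_nonneg fun j _ => hnn a j
  have hyρ : ∀ a j, y a j ≤ ρ := fun a j =>
    (Finset.single_le_sum (fun j _ => hnn a j) (Finset.mem_univ j)).trans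
      (Finset.single_le_sum (f := fun a => ∑ j, y a j)
        (fun a _ => Finset.sum_nonneg fun j _ => hnn a j) (Finset.mem_univ a))
  refine le_of_forall_pow_le_mul_pow (C := 4 * (2 * (m * (n * (2 * ρ))) / δ₀ + 1) ^ m)
    (by positivity) fun q hq => ?_
  refine (card_pow_le_of_recoversNonneg hA hK hr y hy hclose hsep hρ hyρ hδ₀ hNδ₀ hq).trans_eq ?_
  rw [mul_pow, mul_pow 4, ← pow_mul, ← pow_mul, show 2 * q * m = 2 * m * q by ring]
  ring

/-- Without measurements it is impossible to recover two different sparse vectors. -/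
theorem seminorm_sub_eq_zero_of_recoversNonneg {Ω : Type*} [MeasurableSpace Ω] {n k : ℕ}
    {A : LinearScheme Ω 0 n} {P : Measure Ω} [IsProbabilityMeasure P]
    {N : Seminorm ℝ (Fin n → ℝ)} {K : ℝ} (hA : A.RecoversNonneg P N k K) (hK : 0 ≤ K)
    {x y : Fin n → ℝ} (hx : x ∈ nonnegSparse n k) (hy : y ∈ nonnegSparse n k) :
    N (x - y) = 0 := by
  have hP : ∀ z ∈ nonnegSparse n k,
      3 ≤ 4 * P {ω | N (z - A.recover ω (A.mat ω *ᵥ z)) ≤ K * 0} := fun z hz =>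
    hA.three_le hK hz.1 hz.2 (by simp)
  have hm : MeasurableSet {ω | N (y - A.recover ω (A.mat ω *ᵥ y)) ≤ K * 0} :=
    measurable_prodMk_right (y := (0 : Fin n → ℝ))
      (measurableSet_recover A N (fun _ => y) measurable_const (K * 0))
  -- Two events of probability at least `3 / 4` meet. At a common seed the single output, which does
  -- not depend on the input, is at distance zero from both vectors.
  by_cases hd : Disjoint {ω | N (x - A.recover ω (A.mat ω *ᵥ x)) ≤ K * 0}
      {ω | N (y - A.recover ω (A.mat ω *ᵥ y)) ≤ K * 0}
  · have h1 := add_le_add (hP x hx) (hP y hy)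
    rw [← mul_add, ← measure_union hd hm] at h1
    have h2 := h1.trans (mul_le_mul_right prob_le_one 4)
    norm_num at h2
  · obtain ⟨ω, h1, h2⟩ := Set.not_disjoint_iff.1 hd
    have h1 := Set.mem_ofPred.1 h1
    have h2 := Set.mem_ofPred.1 h2
    rw [Subsingleton.elim (A.mat ω *ᵥ x) (A.mat ω *ᵥ y)] at h1
    refine le_antisymm ?_ (apply_nonneg _ _)
    have h3 := map_sub_le_add N (x - A.recover ω (A.mat ω *ᵥ y)) (y - A.recover ω (A.mat ω *ᵥ y))
    rw [sub_sub_sub_cancel_right] at h3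
    linarith

/-! ### From separated sets to the doubling dimension -/

/-- For `m ≥ 1` the factor 4 in `card_le_of_recoversNonneg` is absorbed by replacing 32 with 64. For
`m = 0` that bound is too weak, since the doubling constant must be at most one. -/
theorem log_doublingConstant_le {Ω : Type*} [MeasurableSpace Ω] {m n k : ℕ}
    {A : LinearScheme Ω m n} {P : Measure Ω} [IsProbabilityMeasure P]
    {N : Seminorm ℝ (Fin n → ℝ)} {K : ℝ} (hA : A.RecoversNonneg P N k K) (hK : 0 < K) :
    Real.log (doublingConstant N (nonnegSparse n k)) ≤ 2 * m * Real.log (64 * (K + 1)) := by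
  have hlog : 0 ≤ Real.log (64 * (K + 1)) := Real.log_nonneg (by linarith)
  -- The value `0`, which `sInf` assigns to the empty set, is harmless because `Real.log 0 = 0`.
  rcases Nat.eq_zero_or_pos (doublingConstant N (nonnegSparse n k)) with h0 | hpos
  · rw [h0, Nat.cast_zero, Real.log_zero]
    positivity
  obtain ⟨l, hl⟩ := Nat.exists_eq_add_of_lt hpos
  rw [zero_add] at hl
  obtain ⟨p, r, hr, y, hy, hsep⟩ := exists_separated_of_lt_doublingConstant N (nonnegSparse n k)
    (l := l) (by omega)
  have hclose : ∀ a b, N (y a - y b) ≤ 2 * r := fun a b => by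
    have := map_sub_le_add N (y a - p) (y b - p)
    rw [sub_sub_sub_cancel_right] at this
    linarith [(hy a).2, (hy b).2]
  rcases Nat.eq_zero_or_pos m with rfl | hm
  · have hl0 : l = 0 := by
      by_contra hne
      have h1 := hsep 0 (Fin.last l) (fun h => hne (by simpa using (congrArg Fin.val h).symm))
      rw [seminorm_sub_eq_zero_of_recoversNonneg hA hK.le (hy _).1 (hy _).1] at h1
      linarith
    rw [hl, hl0]
    simp
  · have h1 := card_le_of_recoversNonneg hA hK hr y (fun a => (hy a).1) hclose hsep
    rw [Fintype.card_fin, ← hl] at h1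
    have h2 : (4 : ℝ) * (32 * (K + 1)) ^ (2 * m) ≤ (64 * (K + 1)) ^ (2 * m) := by
      have h3 : (64 * (K + 1)) ^ (2 * m) = 2 ^ (2 * m) * (32 * (K + 1)) ^ (2 * m) := by
        rw [← mul_pow]; ring
      have h4 : (2 : ℝ) ^ 2 ≤ 2 ^ (2 * m) := pow_le_pow_right₀ (by norm_num) (by omega)
      rw [h3]
      gcongr
      linarith
    have h5 := Real.log_le_log (by exact_mod_cast hpos) (h1.trans h2)
    rw [Real.log_pow] at h5
    exact_mod_cast h5

theorem theoremt (c K₀ : ℝ) (hK₀ : 1 < K₀) :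
    ∃ C : ℝ, 0 < C ∧
      ∀ (n k m : ℕ) (K : ℝ), K₀ ≤ K →
      ∀ N : Seminorm ℝ (Fin n → ℝ), PolyBounded c N →
      ∀ (Ω : Type*) [MeasurableSpace Ω] (P : Measure Ω) [IsProbabilityMeasure P]
        (A : LinearScheme Ω m n), A.RecoversNonneg P N k K →
        C * (doublingDim N (nonnegSparse n k) / Real.log K) ≤ m := by
  have hlog₀ : 0 < Real.log K₀ := Real.log_pos hK₀
  have hlog2 : 0 < Real.log 2 := Real.log_pos one_lt_two
  have hlog128 : 0 < Real.log 128 := Real.log_pos (by norm_num)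
  -- From `64 * (K + 1) ≤ 128 * K` and `Real.log K₀ ≤ Real.log K`, the logarithm of `64 * (K + 1)`
  -- is at most `1 + Real.log 128 / Real.log K₀` times that of `K`; `Real.log 2` converts to base
  -- two.
  refine ⟨Real.log 2 / (2 * (1 + Real.log 128 / Real.log K₀)), by positivity, ?_⟩
  intro n k m K hK N _ Ω _ P _ A hA
  have hK1 : 1 < K := hK₀.trans_le hK
  have hlogK : Real.log K₀ ≤ Real.log K := Real.log_le_log (by linarith) hK
  have h1 := log_doublingConstant_le hA (by linarith)
  have h2 : Real.log (64 * (K + 1)) ≤ (1 + Real.log 128 / Real.log K₀) * Real.log K := by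
    have h3 : Real.log (64 * (K + 1)) ≤ Real.log 128 + Real.log K := by
      rw [← Real.log_mul (by norm_num) (by linarith)]
      exact Real.log_le_log (by linarith) (by linarith)
    have h4 : Real.log 128 ≤ Real.log 128 / Real.log K₀ * Real.log K := by
      rw [div_mul_eq_mul_div, le_div_iff₀ hlog₀]
      exact mul_le_mul_of_nonneg_left hlogK hlog128.le
    linarith
  have h5 : Real.log (doublingConstant N (nonnegSparse n k)) ≤
      m * (2 * (1 + Real.log 128 / Real.log K₀) * Real.log K) := by
    have := mul_le_mul_of_nonneg_left h2 (show (0 : ℝ) ≤ 2 * m by positivity)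
    linarith
  have h6 : 0 < Real.log K := hlog₀.trans_le hlogK
  have h7 : Real.log 2 / (2 * (1 + Real.log 128 / Real.log K₀)) *
      (doublingDim N (nonnegSparse n k) / Real.log K) =
      Real.log (doublingConstant N (nonnegSparse n k)) /
        (2 * (1 + Real.log 128 / Real.log K₀) * Real.log K) := by
    rw [doublingDim, Real.logb]
    generalize 1 + Real.log 128 / Real.log K₀ = a
    field_simp
  rw [h7, div_le_iff₀ (by positivity)]
  exact h5
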